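/- Let $G$ be a finite group and $\operatorname{Irr} G$ its set of irreducible complex characters. For $X\subseteq\operatorname{Irr}G$ put $\sigma_X=\sum_{\chi\in X}\chi(1)\chi$, and for $K\subseteq G$ put $\chi(\hat K)=\sum_{g\in K}\chi(g)$. A supercharacter theory of $G$ is a pair $(\mathcal X,\mathcal K)$ consisting of a partition $\mathcal X$ of $\operatorname{Irr}G$ and a partition $\mathcal K$ of $G$ such that $|\mathcal X|=|\mathcal K|$ and every $\sigma_X$ with $X\in\mathcal X$ is constant on each member of $\mathcal K$; the members of $\mathcal K$ are its superclasses. One supercharacter theory $(\mathcal Y,\mathcal L)$ is finer than another $(\mathcal X,\mathcal K)$ (and the latter coarser) if $\mathcal Y$ refines $\mathcal X$; equivalently, if $\mathcal L$ refines $\mathcal K$. For a collection $\mathcal X$ of subsets of $\operatorname{Irr}G$, let $C(\mathcal X)$ be the partition of $G$ into the classes of the equivalence relation: $g\sim h$ if and only if $\sigma_X(g)=\sigma_X(h)$ for all $X\in\mathcal X$. For a collection $\mathcal K$ of normal (i.e. conjugation-invariant) subsets of $G$, let $I(\mathcal K)$ be the partition of $\operatorname{Irr}G$ into the classes of the equivalence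 relation: $\chi\sim\psi$ if and only if $\chi(\hat K)/\chi(1)=\psi(\hat K)/\psi(1)$ for all $K\in\mathcal K$. (a) Let $K\subseteq G$ be a normal subset. There is a supercharacter theory $(\mathcal X,\mathcal K)$ of $G$ with $K\in\mathcal K$ if and only if $K\in(CI)^n(\{K\})$ for all $n>0$. If this is the case, then for all sufficiently large $n$ the pair $\big(I(CI)^n(\{K\}),\,(CI)^n(\{K\})\big)$ is the coarsest supercharacter theory of $G$ having $K$ as a superclass. (b) Let $X\subseteq\operatorname{Irr}G$ be any subset. There is a supercharacter theory $(\mathcal X,\mathcal K)$ of $G$ with $X\in\mathcal X$ if and only if $X\in(IC)^n(\{X\})$ for all $n>0$. If this is the case, then for all sufficiently large $n$ the pair $\big((IC)^n(\{X\}),\,C(IC)^n(\{X\})\big)$ is the coarsest supercharacter theory $(\mathcal X,\mathcal K)$ of $G$ with $X\in\mathcal X$. -/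

import Mathlib

namespace SCT

/-! ### Irreducible complex characters of a finite group -/

/-- The set of irreducible complex characters of `G`, as functions `G → ℂ`: the characters of the
irreducible representations of `G` on the spaces `ℂⁿ`. -/
def irrSet (G : Type*) [Group G] : Set (G → ℂ) :=
  {χ | ∃ (n : ℕ) (ρ : Representation ℂ G (Fin n → ℂ)), ρ.IsIrreducible ∧ ρ.character = χ}

/-- `Irr G`, the type of irreducible complex characters of `G`. -/
abbrev Irr (G : Type*) [Group G] : Type _ := ↥(irrSet G)

theorem irr_orthonormal {G : Type*} [Group G] [Fintype G] [DecidableEq (Irr G)] (χ ψ : Irr G) :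
    (Nat.card G : ℂ)⁻¹ * ∑ g : G, χ.1 g * ψ.1 g⁻¹ = if χ = ψ then 1 else 0 := by
  obtain ⟨χ, n, ρ, hρ, rfl⟩ := χ
  obtain ⟨ψ, m, τ, hτ, rfl⟩ := ψ
  have hc : (Nat.card G : ℂ) ≠ 0 := by exact_mod_cast Nat.card_pos.ne'
  have : Invertible (Nat.card G : ℂ) := invertibleOfNonzero hc
  by_cases h : ρ.character = τ.character
  · have key := Representation.char_orthonormal ρ ρ
    rw [if_pos ⟨Representation.Equiv.refl ρ⟩] at key
    rw [if_pos (Subtype.ext h), ← key]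
    simp only [h]
  · have key := Representation.char_orthonormal ρ τ
    rw [if_neg (fun ⟨e⟩ => h (Representation.char_iso e).symm)] at key
    rw [if_neg (fun e => h (congrArg Subtype.val e)), ← key]

/-- A finite group has only finitely many irreducible characters. In particular, all the
sums over subsets of `Irr G` and of `G` below are honest finite sums. -/
instance irr_finite (G : Type*) [Group G] [Finite G] : Finite (Irr G) := by
  classical
  have := Fintype.ofFinite G
  have hli : LinearIndependent ℂ (fun χ : Irr G => (χ.1 : G → ℂ)) := by
    rw [linearIndependent_iff']
    intro s c hs ψ hψ
    have h1 : ∀ g : G, ∑ χ ∈ s, c χ * χ.1 g = 0 := fun g => by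
      simpa using congrFun hs g
    have h2 : ∑ χ ∈ s, c χ * ((Nat.card G : ℂ)⁻¹ * ∑ g : G, χ.1 g * ψ.1 g⁻¹) = 0 := by
      calc ∑ χ ∈ s, c χ * ((Nat.card G : ℂ)⁻¹ * ∑ g : G, χ.1 g * ψ.1 g⁻¹)
          = (Nat.card G : ℂ)⁻¹ * ∑ g : G, (∑ χ ∈ s, c χ * χ.1 g) * ψ.1 g⁻¹ := by
            simp only [Finset.mul_sum, Finset.sum_mul]
            rw [Finset.sum_comm]
            exact Finset.sum_congr rfl fun g _ => Finset.sum_congr rfl fun χ _ => by ring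
        _ = 0 := by simp [h1]
    simp only [irr_orthonormal] at h2
    simpa [hψ] using h2
  exact hli.finite

/-! ### Partitions and supercharacter theories -/

/-- `𝒜 ≼ ℬ`, that is, `𝒜` is finer than `ℬ`: every block of `𝒜` is contained in a block of `ℬ`. -/
def Finer {α : Type*} (𝒜 ℬ : Set (Set α)) : Prop :=
  ∀ A ∈ 𝒜, ∃ B ∈ ℬ, A ⊆ B

/-- Normal subsets of `G`: subsets that are invariant under conjugation by `G`. -/
def IsNormalSubset {G : Type*} [Group G] (K : Set G) : Prop :=
  ∀ g : G, ∀ k ∈ K, g * k * g⁻¹ ∈ K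

/-- The function `σ_X = ∑_{χ ∈ X} χ(1) χ`, for `X ⊆ Irr G`. -/
noncomputable def sigma {G : Type*} [Group G] (X : Set (Irr G)) (g : G) : ℂ :=
  ∑ᶠ χ ∈ X, χ.1 1 * χ.1 g

/-- The value `χ(K̂) = ∑_{g ∈ K} χ(g)` of (the linear extension of) `χ` at the element
`K̂ = ∑_{g ∈ K} g` of the group algebra. -/
noncomputable def valueAtSum {G : Type*} [Group G] (χ : Irr G) (K : Set G) : ℂ :=
  ∑ᶠ g ∈ K, χ.1 g

/-- `(𝒳, 𝒦)` is a supercharacter theory of `G`. -/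
structure IsSupercharacterTheory {G : Type*} [Group G]
    (𝒳 : Set (Set (Irr G))) (𝒦 : Set (Set G)) : Prop where
  isPartition_irr : Setoid.IsPartition 𝒳
  isPartition_group : Setoid.IsPartition 𝒦
  card_eq : 𝒳.encard = 𝒦.encard
  sigma_const : ∀ X ∈ 𝒳, ∀ K ∈ 𝒦, ∀ g ∈ K, ∀ h ∈ K, sigma X g = sigma X h

/-- `(𝒳, 𝒦)` is the coarsest among the supercharacter theories of `G` with the property `P`:
it has the property, and every other one is finer (in both components). -/
def IsCoarsestWith {G : Type*} [Group G]
    (P : Set (Set (Irr G)) → Set (Set G) → Prop)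
    (𝒳 : Set (Set (Irr G))) (𝒦 : Set (Set G)) : Prop :=
  IsSupercharacterTheory 𝒳 𝒦 ∧ P 𝒳 𝒦 ∧
    ∀ (𝒴 : Set (Set (Irr G))) (ℒ : Set (Set G)),
      IsSupercharacterTheory 𝒴 ℒ → P 𝒴 ℒ → Finer 𝒴 𝒳 ∧ Finer ℒ 𝒦

/-! ### The maps `C` and `I` -/

/-- `g ∼ h` if and only if `σ_X(g) = σ_X(h)` for all `X ∈ 𝒳`. -/
def classSetoid {G : Type*} [Group G] (𝒳 : Set (Set (Irr G))) : Setoid G where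
  r g h := ∀ X ∈ 𝒳, sigma X g = sigma X h
  iseqv := ⟨fun _ _ _ => rfl, fun h X hX => (h X hX).symm,
    fun h₁ h₂ X hX => (h₁ X hX).trans (h₂ X hX)⟩

/-- The class partition `C(𝒳)`, a partition of `G`. -/
def classPartition {G : Type*} [Group G] (𝒳 : Set (Set (Irr G))) : Set (Set G) :=
  (classSetoid 𝒳).classes

/-- `χ ∼ ψ` if and only if `χ(K̂)/χ(1) = ψ(K̂)/ψ(1)` for all `K ∈ 𝒦`. -/
def irrSetoid {G : Type*} [Group G] (𝒦 : Set (Set G)) : Setoid (Irr G) where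
  r χ ψ := ∀ K ∈ 𝒦, valueAtSum χ K / χ.1 1 = valueAtSum ψ K / ψ.1 1
  iseqv := ⟨fun _ _ _ => rfl, fun h K hK => (h K hK).symm,
    fun h₁ h₂ K hK => (h₁ K hK).trans (h₂ K hK)⟩

/-- The character partition `I(𝒦)`, a partition of `Irr G`. It is only used for collections `𝒦`
of normal subsets of `G`. -/
def irrPartition {G : Type*} [Group G] (𝒦 : Set (Set G)) : Set (Set (Irr G)) :=
  (irrSetoid 𝒦).classes

/-- `(CI)ⁿ(𝒦)`. -/
def iterCI {G : Type*} [Group G] (n : ℕ) (𝒦 : Set (Set G)) : Set (Set G) :=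
  (fun ℒ => classPartition (irrPartition ℒ))^[n] 𝒦

/-- `(IC)ⁿ(𝒳)`. -/
def iterIC {G : Type*} [Group G] (n : ℕ) (𝒳 : Set (Set (Irr G))) : Set (Set (Irr G)) :=
  (fun 𝒴 => irrPartition (classPartition 𝒴))^[n] 𝒳

end SCT

/-! Everything rests on two dual systems inside `G → ℂ`. Evaluation at `g` is dual to the indicators
of subsets of `G`; the normalized coefficient `f ↦ ⟨f, χ⟩ / χ(1)` sends `σ_X` to the indicator of
`X`, by orthonormality. Up to conjugation and the factor `1 / |G|`, the coefficient of `𝟙_K` is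
`χ(K̂) / χ(1)`. So `C` groups the points that the span of the `σ_X` cannot separate, and `I` groups
the characters whose coefficients the span of the `𝟙_K` cannot separate.

Since irreducible characters span the class functions, each `𝟙_K` with `K ∈ 𝒦` normal lies in the
span of the `σ_X`, `X ∈ I(𝒦)`; likewise each `σ_X` with `X ∈ 𝒳` lies in the span of the indicators
of the blocks of `C(𝒳)`. By a dimension count, supercharacter theories are exactly the pairs with
`I(𝒦) = 𝒳` and `C(𝒳) = 𝒦` (`isSupercharacterTheory_iff`).

The rest is order theory (`IsCompatible`). Monotonicity makes every theory with block `A` finer than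
all iterates of `{A}`, which forces `A` to remain a block. Conversely, if `A` survives in every
iterate, the iterates get finer and, by finiteness, stop at a fixed pair, which is then the coarsest
theory with block `A`. -/

namespace SCT

open Module Representation

/-! ### Irreducible characters: inversion and completeness -/

/-- The trace of the inverse of a complex endomorphism of finite order is the complex conjugate
of its trace. -/
theorem trace_eq_conj_trace_of_mul_eq_one {V : Type*} [AddCommGroup V] [Module ℂ V]
    [FiniteDimensional ℂ V] {s t : End ℂ V} {n : ℕ} (hn : n ≠ 0) (hs : s ^ n = 1)
    (hts : t * s = 1) :
    LinearMap.trace ℂ V t = starRingEnd ℂ (LinearMap.trace ℂ V s) := by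
  classical
  -- `X ^ n - 1` is separable over `ℂ` and annihilates `s`, so `s` has an eigenbasis; its
  -- eigenvalues are roots of unity, whose inverses are their conjugates.
  have hss : s.IsSemisimple := by
    refine End.isSemisimple_of_squarefree_aeval_eq_zero
      (p := Polynomial.X ^ n - Polynomial.C (1 : ℂ)) ?_ (by simp [hs])
    exact (Polynomial.separable_X_pow_sub_C 1 (by exact_mod_cast hn) one_ne_zero).squarefree
  let D := DirectSum.isInternal_submodule_of_iSupIndep_of_iSup_eq_top
    s.eigenspaces_iSupIndep hss.iSup_eigenspace_eq_top
  let I := (ν : ℂ) × Fin (finrank ℂ (s.eigenspace ν))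
  let v : Basis I ℂ V := D.collectedBasis fun μ ↦ finBasis ℂ (s.eigenspace μ)
  have : Fintype I := FiniteDimensional.fintypeBasisIndex v
  have hsv (i : I) : s (v i) = i.1 • v i :=
    End.mem_eigenspace_iff.mp (D.collectedBasis_mem _ i)
  have hpow (i : I) : i.1 ^ n = 1 := by
    have h : ∀ m : ℕ, (s ^ m) (v i) = i.1 ^ m • v i := fun m => by
      induction m with
      | zero => simp
      | succ m ih => rw [pow_succ', Module.End.mul_apply, ih, map_smul, hsv, smul_smul, pow_succ]
    have h1 := h n
    rw [hs, Module.End.one_apply] at h1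
    have h2 : (i.1 ^ n - 1) • v i = 0 := by rw [sub_smul, one_smul, ← h1, sub_self]
    exact sub_eq_zero.mp ((smul_eq_zero.mp h2).resolve_right (v.ne_zero i))
  have hconj (i : I) : starRingEnd ℂ i.1 * i.1 = 1 := by
    rw [mul_comm, Complex.mul_conj, Complex.normSq_eq_norm_sq,
      Complex.norm_eq_one_of_pow_eq_one (hpow i) hn]
    simp
  have htv (i : I) : t (v i) = starRingEnd ℂ i.1 • v i := by
    have h1 : t (s (v i)) = v i := by
      rw [← Module.End.mul_apply, hts, Module.End.one_apply]
    rw [hsv, map_smul] at h1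
    calc t (v i) = (starRingEnd ℂ i.1 * i.1) • t (v i) := by rw [hconj, one_smul]
      _ = _ := by rw [mul_smul, h1]
  rw [LinearMap.trace_eq_matrix_trace ℂ v, LinearMap.trace_eq_matrix_trace ℂ v]
  simp [Matrix.trace, LinearMap.toMatrix_apply, hsv, htv]

theorem irr_inv {G : Type*} [Group G] [Finite G] (χ : Irr G) (g : G) :
    χ.1 g⁻¹ = starRingEnd ℂ (χ.1 g) := by
  obtain ⟨_, n, ρ, hρ, rfl⟩ := χ
  refine trace_eq_conj_trace_of_mul_eq_one (n := Nat.card G) Nat.card_pos.ne' ?_ ?_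
  · rw [← map_pow, pow_card_eq_one', map_one]
  · rw [← map_mul, inv_mul_cancel, map_one]

theorem irr_conj {G : Type*} [Group G] (χ : Irr G) (g h : G) :
    χ.1 (h * g * h⁻¹) = χ.1 g := by
  obtain ⟨_, n, ρ, hρ, rfl⟩ := χ
  exact char_conj ρ g h

theorem irr_one_ne_zero {G : Type*} [Group G] (χ : Irr G) : χ.1 1 ≠ 0 := by
  obtain ⟨_, n, ρ, hρ, rfl⟩ := χ
  obtain ⟨A, B, hAB⟩ := exists_pair_ne (Subrepresentation ρ)
  have : n ≠ 0 := by
    rintro rfl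
    exact hAB (SetLike.ext fun x => by
      rw [Subsingleton.elim x 0]
      exact ⟨fun _ => B.toSubmodule.zero_mem, fun _ => A.toSubmodule.zero_mem⟩)
  simpa using this

/-- The character of an irreducible representation on any finite-dimensional complex vector space
belongs to `irrSet G`. -/
theorem character_mem_irrSet {G V : Type*} [Group G] [AddCommGroup V] [Module ℂ V]
    [FiniteDimensional ℂ V] (ρ : Representation ℂ G V) (hρ : ρ.IsIrreducible) :
    ρ.character ∈ irrSet G := by
  let e : V ≃ₗ[ℂ] (Fin (finrank ℂ V) → ℂ) := (finBasis ℂ V).equivFun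
  let σ : Representation ℂ G (Fin (finrank ℂ V) → ℂ) :=
    { toFun := fun g => e.conj (ρ g)
      map_one' := by ext; simp
      map_mul' := fun g h => by ext; simp [LinearEquiv.conj_apply] }
  let φ : ρ.Equiv σ := Representation.Equiv.mk e fun g => by
    ext x
    simp [σ, LinearEquiv.conj_apply]
  refine ⟨_, σ, ?_, (char_iso φ).symm⟩
  rw [irreducible_iff_isSimpleModule_asModule] at hρ ⊢
  have hb : Function.Bijective
      (IntertwiningMap.equivLinearMapAsModule ρ σ φ.toIntertwiningMap) := e.bijective
  exact IsSimpleModule.congr (LinearEquiv.ofBijective _ hb).symm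

/-- Schur: a class function orthogonal to an irreducible character acts as zero. -/
theorem sum_smul_eq_zero_of_isIrreducible {G V : Type*} [Group G] [Fintype G] [AddCommGroup V]
    [Module ℂ V] [FiniteDimensional ℂ V] (ρ : Representation ℂ G V) [hρ : ρ.IsIrreducible]
    {f : G → ℂ} (hf : ∀ g h, f (h * g * h⁻¹) = f g) (h0 : ∑ g, f g * ρ.character g = 0) :
    ∑ g, f g • ρ g = 0 := by
  have hcomm (h : G) : (∑ g, f g • ρ g) * ρ h = ρ h * ∑ g, f g • ρ g := by
    rw [Finset.sum_mul, Finset.mul_sum, ← (MulAut.conj h).toEquiv.sum_comp]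
    refine Finset.sum_congr rfl fun g _ => ?_
    simp only [MulEquiv.toEquiv_eq_coe, MulEquiv.coe_toEquiv, MulAut.conj_apply, hf,
      smul_mul_assoc, mul_smul_comm, ← map_mul]
    simp
  let T : IntertwiningMap ρ ρ :=
    ⟨∑ g, f g • ρ g, fun h => by
      simpa [Module.End.mul_eq_comp] using hcomm h⟩
  obtain ⟨c, hc⟩ :=
    (IsIrreducible.algebraMap_intertwiningMap_bijective_of_isAlgClosed (ρ := ρ)).2 T
  have hT : ∑ g, f g • ρ g = c • (1 : End ℂ V) := by
    have := congrArg IntertwiningMap.toLinearMap hc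
    rw [Algebra.algebraMap_eq_smul_one] at this
    exact this.symm
  -- Taking traces turns the orthogonality hypothesis into `c * dim V = 0`.
  have htr : c * ρ.character 1 = 0 := by
    have := congrArg (LinearMap.trace ℂ V) hT
    simp only [map_sum, map_smul, smul_eq_mul, LinearMap.trace_one] at this
    rw [char_one, ← this]
    exact h0
  have hne := irr_one_ne_zero (⟨_, character_mem_irrSet ρ hρ⟩ : Irr G)
  rw [hT, (mul_eq_zero.mp htr).resolve_right hne, zero_smul]

/-- A class function orthogonal to all irreducible characters annihilates every simple module over
the group algebra. -/
theorem sum_single_smul_eq_zero_of_isSimpleModule {G M : Type*} [Group G] [Fintype G]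
    [AddCommGroup M] [Module (MonoidAlgebra ℂ G) M] [hM : IsSimpleModule (MonoidAlgebra ℂ G) M]
    {f : G → ℂ} (hf : ∀ g h, f (h * g * h⁻¹) = f g) (h0 : ∀ χ : Irr G, ∑ g, f g * χ.1 g = 0)
    (x : M) : (∑ g, MonoidAlgebra.single g (f g)) • x = 0 := by
  let : Module ℂ M := .compHom M (algebraMap ℂ (MonoidAlgebra ℂ G))
  have : IsScalarTower ℂ (MonoidAlgebra ℂ G) M := .of_compHom _ _ _
  let ρ : Representation ℂ G M := ofModule' M
  have hact : ρ.asAlgebraHom = Algebra.lsmul ℂ ℂ M := by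
    simp only [asAlgebraHom, ρ, ofModule', Equiv.apply_symm_apply]
  have hρ : ρ.IsIrreducible := by
    rw [irreducible_iff_isSimpleModule_asModule]
    let e : ρ.asModule ≃ₗ[MonoidAlgebra ℂ G] M :=
      { ρ.asModuleEquiv.toAddEquiv with
        map_smul' := fun r x => by
          have := asModuleEquiv_map_smul ρ r x
          rw [hact] at this
          exact this }
    exact IsSimpleModule.congr e
  have : FiniteDimensional ℂ M := Module.Finite.trans (MonoidAlgebra ℂ G) M
  have h1 := sum_smul_eq_zero_of_isIrreducible ρ hf (h0 ⟨_, character_mem_irrSet ρ hρ⟩)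
  have h2 : ρ.asAlgebraHom (∑ g, MonoidAlgebra.single g (f g)) = 0 := by
    simp only [map_sum, asAlgebraHom_single]
    exact h1
  rw [hact] at h2
  exact LinearMap.congr_fun h2 x

/-- The irreducible characters span the class functions: a class function orthogonal to all of them
vanishes. -/
theorem eq_zero_of_forall_sum_mul_irr_eq_zero {G : Type*} [Group G] [Fintype G]
    {f : G → ℂ} (hf : ∀ g h, f (h * g * h⁻¹) = f g) (h0 : ∀ χ : Irr G, ∑ g, f g * χ.1 g = 0) :
    f = 0 := by
  classical
  have hz : ∑ g, (MonoidAlgebra.single g (f g) : MonoidAlgebra ℂ G) = 0 := by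
    -- The element kills all simple quotients, so it lies in the Jacobson radical, which is zero by
    -- Maschke's theorem.
    have hmem : ∑ g, (MonoidAlgebra.single g (f g) : MonoidAlgebra ℂ G) ∈
        Module.jacobson (MonoidAlgebra ℂ G) (MonoidAlgebra ℂ G) := by
      refine Submodule.mem_sInf.mpr fun m hm => ?_
      have hs : IsSimpleModule (MonoidAlgebra ℂ G) (MonoidAlgebra ℂ G ⧸ m) :=
        isSimpleModule_iff_isCoatom.mpr hm
      have h3 := sum_single_smul_eq_zero_of_isSimpleModule hf h0
        (Submodule.Quotient.mk 1 : MonoidAlgebra ℂ G ⧸ m)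
      rwa [← Submodule.Quotient.mk_smul, smul_eq_mul, mul_one,
        Submodule.Quotient.mk_eq_zero] at h3
    have : NeZero (Nat.card G : ℂ) := ⟨by exact_mod_cast Nat.card_pos.ne'⟩
    rwa [IsSemisimpleModule.jacobson_eq_bot, Submodule.mem_bot] at hmem
  ext g
  have := congrArg (fun w : MonoidAlgebra ℂ G => w.coeff g) hz
  simpa [MonoidAlgebra.coeff_sum, Finsupp.single_apply] using this

end SCT

namespace SCT

/-! ### Functions that are constant on the blocks of a partition -/

section Dual

variable {α M : Type*} [AddCommGroup M] [Module ℂ M] {φ : α → M →ₗ[ℂ] ℂ} {v : Set α → M}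

theorem apply_eq_apply_of_mem_span {S : Set M} {a b : α} (h : ∀ w ∈ S, φ a w = φ b w)
    {f : M} (hf : f ∈ Submodule.span ℂ S) : φ a f = φ b f :=
  LinearMap.eqOn_span (s := S) h hf

/-- If the functionals `φ a` are dual to the vectors `v A`, then a vector on which `φ` is constant on
the blocks of a partition is a linear combination of the vectors attached to the blocks. -/
theorem mem_span_image_of_isPartition [Finite α] {P : Set (Set α)} (hP : Setoid.IsPartition P)
    (hv : ∀ A a, φ a (v A) = A.indicator 1 a) {W : Submodule ℂ M} (hvW : ∀ A ∈ P, v A ∈ W)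
    (hW : ∀ f ∈ W, (∀ a, φ a f = 0) → f = 0) {f : M} (hf : f ∈ W)
    (hc : ∀ A ∈ P, ∀ a ∈ A, ∀ b ∈ A, φ a f = φ b f) : f ∈ Submodule.span ℂ (v '' P) := by
  classical
  have := Fintype.ofFinite P
  choose s hs using fun A : P => Setoid.nonempty_of_mem_partition hP A.2
  have key : f - ∑ A : P, φ (s A) f • v A = 0 := by
    refine hW _ (W.sub_mem hf (W.sum_mem fun A _ => W.smul_mem _ (hvW A A.2))) fun a => ?_
    obtain ⟨A, ⟨hA, haA⟩, huniq⟩ := hP.2 a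
    rw [map_sub, map_sum, Finset.sum_eq_single (⟨A, hA⟩ : P)]
    · simp [hv, haA, hc A hA a haA _ (hs ⟨A, hA⟩)]
    · intro B _ hBA
      have : a ∉ (B : Set α) := fun haB => hBA (Subtype.ext (huniq B ⟨B.2, haB⟩))
      simp [hv, this]
    · simp
  rw [sub_eq_zero.mp key]
  exact Submodule.sum_mem _ fun A _ =>
    Submodule.smul_mem _ _ (Submodule.subset_span ⟨A, A.2, rfl⟩)

theorem linearIndepOn_of_isPartition {P : Set (Set α)} (hP : Setoid.IsPartition P)
    (hv : ∀ A a, φ a (v A) = A.indicator 1 a) : LinearIndepOn ℂ v P := by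
  classical
  rw [LinearIndepOn, linearIndependent_iff']
  intro s c hs B hB
  obtain ⟨a, ha⟩ := Setoid.nonempty_of_mem_partition hP B.2
  have h := congrArg (φ a) hs
  rw [map_sum, map_zero, Finset.sum_eq_single B] at h
  · simpa [hv, ha] using h
  · intro A _ hAB
    have : a ∉ (A : Set α) := fun haA =>
      hAB (Subtype.ext ((hP.2 a).unique ⟨A.2, haA⟩ ⟨B.2, ha⟩))
    simp [hv, this]
  · exact fun h => (h hB).elim

theorem finrank_span_image_of_isPartition [Finite α] {P : Set (Set α)}
    (hP : Setoid.IsPartition P) (hv : ∀ A a, φ a (v A) = A.indicator 1 a) :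
    Module.finrank ℂ (Submodule.span ℂ (v '' P)) = P.ncard := by
  have := Fintype.ofFinite P
  have h := finrank_span_eq_card (linearIndepOn_of_isPartition hP hv)
  rw [Set.image_eq_range, h, ← Nat.card_eq_fintype_card, Nat.card_coe_set_eq]

end Dual

/-! ### Blocks of equivalence relations and spans of indicators -/

section Blocks

variable {α : Type*}

theorem rel_of_mem_classes {r : Setoid α} {A : Set α} (hA : A ∈ r.classes) {a b : α}
    (ha : a ∈ A) (hb : b ∈ A) : r a b :=
  r.rel_iff_exists_classes.mpr ⟨A, hA, ha, hb⟩

theorem mem_iff_mem_of_indicator_eq {A : Set α} {a b : α}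
    (h : (A.indicator 1 a : ℂ) = A.indicator 1 b) : a ∈ A ↔ b ∈ A := by
  by_cases ha : a ∈ A <;> by_cases hb : b ∈ A <;> simp_all

theorem mem_iff_mem_of_le {r s : Setoid α} (hrs : r ≤ s) {A : Set α}
    (hA : A ∈ s.classes) {a b : α} (h : r a b) : a ∈ A ↔ b ∈ A := by
  obtain ⟨x, rfl⟩ := hA
  exact ⟨fun ha => s.trans (s.symm (hrs h)) ha, fun hb => s.trans (hrs h) hb⟩

theorem eq_classes_of_rel_iff {P : Set (Set α)} (hP : Setoid.IsPartition P)
    {r : Setoid α} (h1 : ∀ A ∈ P, ∀ a ∈ A, ∀ b ∈ A, r a b)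
    (h2 : ∀ A ∈ P, ∀ a b, r a b → (a ∈ A ↔ b ∈ A)) : r.classes = P := by
  rw [← Setoid.classes_mkClasses P hP]
  congr 1
  ext a b
  rw [Setoid.rel_iff_exists_classes (Setoid.mkClasses P hP.2), Setoid.classes_mkClasses P hP]
  constructor
  · intro h
    obtain ⟨A, ⟨hA, ha⟩, -⟩ := hP.2 a
    exact ⟨A, hA, ha, (h2 A hA a b h).mp ha⟩
  · rintro ⟨A, hA, ha, hb⟩
    exact h1 A hA a ha b hb

/-- The span of the indicator functions of the members of `𝒦`. -/
noncomputable def indicatorSpan (𝒦 : Set (Set α)) : Submodule ℂ (α → ℂ) :=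
  Submodule.span ℂ ((fun K : Set α => (K.indicator 1 : α → ℂ)) '' 𝒦)

theorem indicator_mem_indicatorSpan {𝒦 : Set (Set α)} {K : Set α} (hK : K ∈ 𝒦) :
    (K.indicator 1 : α → ℂ) ∈ indicatorSpan 𝒦 :=
  Submodule.subset_span ⟨K, hK, rfl⟩

theorem mem_indicatorSpan [Finite α] {𝒦 : Set (Set α)} (h𝒦 : Setoid.IsPartition 𝒦) {f : α → ℂ}
    (hc : ∀ K ∈ 𝒦, ∀ g ∈ K, ∀ h ∈ K, f g = f h) : f ∈ indicatorSpan 𝒦 :=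
  mem_span_image_of_isPartition (φ := fun g : α => LinearMap.proj g) (W := ⊤) h𝒦
    (fun _ _ => rfl) (fun _ _ => trivial) (fun _ _ h => funext h) trivial hc

theorem finrank_indicatorSpan [Finite α] {𝒦 : Set (Set α)} (h𝒦 : Setoid.IsPartition 𝒦) :
    Module.finrank ℂ (indicatorSpan 𝒦) = 𝒦.ncard :=
  finrank_span_image_of_isPartition (φ := fun g : α => LinearMap.proj g) h𝒦 fun _ _ => rfl

end Blocks

/-! ### Normalized coefficients with respect to the irreducible characters -/

/-- The space of class functions. -/
def classFunctions (G : Type*) [Group G] : Submodule ℂ (G → ℂ) where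
  carrier := {f | ∀ g h, f (h * g * h⁻¹) = f g}
  add_mem' ha hb g h := by simp [ha g h, hb g h]
  zero_mem' _ _ := rfl
  smul_mem' c f hf g h := by simp [hf g h]

theorem indicator_mem_classFunctions {G : Type*} [Group G] {K : Set G} (hK : IsNormalSubset K) :
    (K.indicator 1 : G → ℂ) ∈ classFunctions G := by
  classical
  intro g h
  have : h * g * h⁻¹ ∈ K ↔ g ∈ K :=
    ⟨fun hg => by simpa [mul_assoc] using hK h⁻¹ _ hg, hK h g⟩
  simp only [Set.indicator_apply, this]
  rfl

theorem sigma_eq_sum {G : Type*} [Group G] [Fintype (Irr G)] (X : Set (Irr G)) (g : G) :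
    sigma X g = ∑ χ, X.indicator 1 χ * (χ.1 1 * χ.1 g) := by
  classical
  rw [sigma, finsum_mem_def, finsum_eq_sum_of_fintype]
  refine Finset.sum_congr rfl fun χ _ => ?_
  by_cases h : χ ∈ X <;> simp [h]

section Coefficients

variable {G : Type*} [Group G] [Finite G]

/-- The functional `f ↦ ⟨f, χ⟩ / χ(1)`. -/
noncomputable def irrCoeff (χ : Irr G) : (G → ℂ) →ₗ[ℂ] ℂ :=
  letI := Fintype.ofFinite G
  ((χ.1 1)⁻¹ * (Nat.card G : ℂ)⁻¹) • ∑ g : G, χ.1 g⁻¹ • LinearMap.proj g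

theorem sigma_mem_classFunctions (X : Set (Irr G)) : sigma X ∈ classFunctions G := by
  have := Fintype.ofFinite (Irr G)
  intro g h
  simp only [sigma_eq_sum, irr_conj]

theorem irrCoeff_sigma (X : Set (Irr G)) (χ : Irr G) :
    irrCoeff χ (sigma X) = X.indicator 1 χ := by
  classical
  have := Fintype.ofFinite (Irr G)
  let _ := Fintype.ofFinite G
  have h1 : ∑ ψ : Irr G, X.indicator 1 ψ * ψ.1 1 *
      ((Nat.card G : ℂ)⁻¹ * ∑ g : G, ψ.1 g * χ.1 g⁻¹) = X.indicator 1 χ * χ.1 1 := by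
    simp only [irr_orthonormal]
    simp
  have h2 : irrCoeff χ (sigma X) = (χ.1 1)⁻¹ * ∑ ψ : Irr G, X.indicator 1 ψ * ψ.1 1 *
      ((Nat.card G : ℂ)⁻¹ * ∑ g : G, ψ.1 g * χ.1 g⁻¹) := by
    simp only [irrCoeff, LinearMap.smul_apply, LinearMap.sum_apply, LinearMap.proj_apply,
      smul_eq_mul, sigma_eq_sum, Finset.mul_sum]
    rw [Finset.sum_comm]
    exact Finset.sum_congr rfl fun _ _ => Finset.sum_congr rfl fun _ _ => by ring
  rw [h2, h1]
  field_simp [irr_one_ne_zero χ]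

/-- The conjugate appears because the inner product involves `χ(g⁻¹)`; being injective, conjugation
does not affect the relation defining `I`. -/
theorem irrCoeff_indicator (K : Set G) (χ : Irr G) :
    irrCoeff χ (K.indicator 1) =
      (Nat.card G : ℂ)⁻¹ * starRingEnd ℂ (valueAtSum χ K / χ.1 1) := by
  classical
  let _ := Fintype.ofFinite G
  have h1 : starRingEnd ℂ (χ.1 1) = χ.1 1 := by rw [← irr_inv, inv_one]
  have h2 : valueAtSum χ K = ∑ g : G, K.indicator 1 g * χ.1 g := by
    rw [valueAtSum, finsum_mem_def, finsum_eq_sum_of_fintype]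
    refine Finset.sum_congr rfl fun g _ => ?_
    by_cases h : g ∈ K <;> simp [h]
  have h3 (g : G) : starRingEnd ℂ (K.indicator 1 g) = K.indicator 1 g := by
    by_cases h : g ∈ K <;> simp [h]
  simp only [irrCoeff, LinearMap.smul_apply, LinearMap.sum_apply, LinearMap.proj_apply,
    smul_eq_mul, div_eq_mul_inv, map_mul, map_inv₀, h1, h2, map_sum, h3, irr_inv]
  simp only [mul_comm (starRingEnd ℂ _)]
  ring

theorem eq_zero_of_irrCoeff_eq_zero {f : G → ℂ} (hf : f ∈ classFunctions G)
    (h0 : ∀ χ : Irr G, irrCoeff χ f = 0) : f = 0 := by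
  let _ := Fintype.ofFinite G
  have hc : (Nat.card G : ℂ) ≠ 0 := by exact_mod_cast Nat.card_pos.ne'
  -- The coefficients pair `f(g)` with `χ(g⁻¹)`, whereas completeness is stated with `χ(g)`; the
  -- inversion reconciles the two.
  have h : (fun g => f g⁻¹) = 0 := by
    refine eq_zero_of_forall_sum_mul_irr_eq_zero (fun g h => ?_) fun χ => ?_
    · rw [← hf g⁻¹ h]
      simp [mul_assoc]
    · have := h0 χ
      simp only [irrCoeff, LinearMap.smul_apply, LinearMap.sum_apply, LinearMap.proj_apply,
        smul_eq_mul, mul_eq_zero, inv_eq_zero, irr_one_ne_zero, hc, false_or] at this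
      rw [← this, ← Equiv.sum_comp (Equiv.inv G)]
      exact Finset.sum_congr rfl fun g _ => by simp [mul_comm]
  ext g
  simpa using congrFun h g⁻¹

end Coefficients

/-! ### The spans of the `σ_X` and of the class indicators -/

section Spans

variable {G : Type*} [Group G] [Finite G]

/-- The span of the functions `σ_X`, `X ∈ 𝒳`. -/
noncomputable def sigmaSpan (𝒳 : Set (Set (Irr G))) : Submodule ℂ (G → ℂ) :=
  Submodule.span ℂ (sigma '' 𝒳)

theorem sigma_mem_sigmaSpan {G : Type*} [Group G] {𝒳 : Set (Set (Irr G))} {X : Set (Irr G)} (hX : X ∈ 𝒳) :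
    sigma X ∈ sigmaSpan 𝒳 :=
  Submodule.subset_span ⟨X, hX, rfl⟩

theorem classSetoid_iff {G : Type*} [Group G] {𝒳 : Set (Set (Irr G))} {g h : G} :
    classSetoid 𝒳 g h ↔ ∀ f ∈ sigmaSpan 𝒳, f g = f h := by
  refine ⟨fun H f hf => ?_, fun H X hX => H _ (sigma_mem_sigmaSpan hX)⟩
  refine apply_eq_apply_of_mem_span (φ := fun g : G => LinearMap.proj (R := ℂ) g) ?_ hf
  rintro _ ⟨X, hX, rfl⟩
  exact H X hX

theorem mem_sigmaSpan {𝒳 : Set (Set (Irr G))} (h𝒳 : Setoid.IsPartition 𝒳) {f : G → ℂ}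
    (hf : f ∈ classFunctions G)
    (hc : ∀ X ∈ 𝒳, ∀ χ ∈ X, ∀ ψ ∈ X, irrCoeff χ f = irrCoeff ψ f) : f ∈ sigmaSpan 𝒳 :=
  mem_span_image_of_isPartition h𝒳 irrCoeff_sigma (fun X _ => sigma_mem_classFunctions X)
    (fun _ => eq_zero_of_irrCoeff_eq_zero) hf hc

theorem finrank_sigmaSpan {𝒳 : Set (Set (Irr G))} (h𝒳 : Setoid.IsPartition 𝒳) :
    Module.finrank ℂ (sigmaSpan 𝒳) = 𝒳.ncard :=
  finrank_span_image_of_isPartition h𝒳 irrCoeff_sigma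

theorem irrSetoid_iff {𝒦 : Set (Set G)} {χ ψ : Irr G} :
    irrSetoid 𝒦 χ ψ ↔ ∀ f ∈ indicatorSpan 𝒦, irrCoeff χ f = irrCoeff ψ f := by
  have hc : (Nat.card G : ℂ)⁻¹ ≠ 0 := inv_ne_zero (by exact_mod_cast Nat.card_pos.ne')
  have key (K : Set G) : irrCoeff χ (K.indicator 1) = irrCoeff ψ (K.indicator 1) ↔
      valueAtSum χ K / χ.1 1 = valueAtSum ψ K / ψ.1 1 := by
    rw [irrCoeff_indicator, irrCoeff_indicator, mul_right_inj' hc, (starRingEnd ℂ).injective.eq_iff]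
  refine ⟨fun H f hf => apply_eq_apply_of_mem_span ?_ hf,
    fun H K hK => (key K).mp (H _ (indicator_mem_indicatorSpan hK))⟩
  rintro _ ⟨K, hK, rfl⟩
  exact (key K).mpr (H K hK)

/-- `𝟙_K` is a linear combination of the `σ_X` with `X ∈ I(𝒦)`. -/
theorem indicatorSpan_le_sigmaSpan {𝒦 : Set (Set G)} (h𝒦 : ∀ K ∈ 𝒦, IsNormalSubset K) :
    indicatorSpan 𝒦 ≤ sigmaSpan (irrPartition 𝒦) := by
  refine Submodule.span_le.mpr ?_
  rintro _ ⟨K, hK, rfl⟩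
  refine mem_sigmaSpan (Setoid.isPartition_classes _) (indicator_mem_classFunctions (h𝒦 K hK)) ?_
  intro X hX χ hχ ψ hψ
  exact irrSetoid_iff.mp (rel_of_mem_classes hX hχ hψ) _ (indicator_mem_indicatorSpan hK)

/-- `σ_X` is a linear combination of the indicators of the blocks of `C(𝒳)`. -/
theorem sigmaSpan_le_indicatorSpan (𝒳 : Set (Set (Irr G))) :
    sigmaSpan 𝒳 ≤ indicatorSpan (classPartition 𝒳) := by
  refine Submodule.span_le.mpr ?_
  rintro _ ⟨X, hX, rfl⟩
  refine mem_indicatorSpan (Setoid.isPartition_classes _) ?_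
  intro K hK g hg h hh
  exact rel_of_mem_classes hK hg hh X hX

/-! ### Blocks under `CI` and `IC`, monotonicity, and fixed pairs -/

theorem mem_iff_mem_of_classSetoid_irrPartition {𝒦 : Set (Set G)}
    (h𝒦 : ∀ K ∈ 𝒦, IsNormalSubset K) {K : Set G} (hK : K ∈ 𝒦) {g h : G}
    (hgh : classSetoid (irrPartition 𝒦) g h) : g ∈ K ↔ h ∈ K :=
  mem_iff_mem_of_indicator_eq <|
    classSetoid_iff.mp hgh _ (indicatorSpan_le_sigmaSpan h𝒦 (indicator_mem_indicatorSpan hK))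

theorem mem_iff_mem_of_irrSetoid_classPartition {𝒳 : Set (Set (Irr G))} {X : Set (Irr G)}
    (hX : X ∈ 𝒳) {χ ψ : Irr G} (h : irrSetoid (classPartition 𝒳) χ ψ) : χ ∈ X ↔ ψ ∈ X := by
  have := irrSetoid_iff.mp h _ (sigmaSpan_le_indicatorSpan 𝒳 (sigma_mem_sigmaSpan hX))
  rw [irrCoeff_sigma, irrCoeff_sigma] at this
  exact mem_iff_mem_of_indicator_eq this

theorem isNormalSubset_of_mem_classPartition {𝒳 : Set (Set (Irr G))} {K : Set G}
    (hK : K ∈ classPartition 𝒳) : IsNormalSubset K := by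
  obtain ⟨x, rfl⟩ := hK
  intro g k hk X hX
  rw [sigma_mem_classFunctions X k g]
  exact hk X hX

/-- A class of the coarser relation is a union of classes of the finer one, so its `σ` lies in the
span of the finer ones. -/
theorem classSetoid_mono {r s : Setoid (Irr G)} (hrs : r ≤ s) :
    classSetoid r.classes ≤ classSetoid s.classes := by
  intro g h hgh X hX
  refine classSetoid_iff.mp hgh _ (mem_sigmaSpan (Setoid.isPartition_classes _)
    (sigma_mem_classFunctions X) fun Y hY χ hχ ψ hψ => ?_)
  classical
  simp only [irrCoeff_sigma, Set.indicator_apply,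
    mem_iff_mem_of_le hrs hX (rel_of_mem_classes hY hχ hψ)]
  rfl

theorem irrSetoid_mono {r s : Setoid G} (hrs : r ≤ s) :
    irrSetoid r.classes ≤ irrSetoid s.classes := by
  intro χ ψ h
  refine irrSetoid_iff.mpr fun f hf => irrSetoid_iff.mp h f ?_
  refine Submodule.span_le.mpr ?_ hf
  rintro _ ⟨K, hK, rfl⟩
  refine mem_indicatorSpan (Setoid.isPartition_classes _) fun L hL g hg h hh => ?_
  classical
  simp only [Set.indicator_apply, mem_iff_mem_of_le hrs hK (rel_of_mem_classes hL hg hh)]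
  rfl

/-- Supercharacter theories are the pairs of collections that are mapped to each other by `I`
and `C`. -/
theorem isSupercharacterTheory_iff {𝒳 : Set (Set (Irr G))} {𝒦 : Set (Set G)} :
    IsSupercharacterTheory 𝒳 𝒦 ↔ irrPartition 𝒦 = 𝒳 ∧ classPartition 𝒳 = 𝒦 := by
  have hfin (𝒵 : Set (Set G)) : 𝒵.encard = 𝒵.ncard := (Set.toFinite 𝒵).cast_ncard_eq.symm
  have hfin' (𝒵 : Set (Set (Irr G))) : 𝒵.encard = 𝒵.ncard := (Set.toFinite 𝒵).cast_ncard_eq.symm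
  constructor
  · intro hT
    have hle : sigmaSpan 𝒳 ≤ indicatorSpan 𝒦 := by
      refine Submodule.span_le.mpr ?_
      rintro _ ⟨X, hX, rfl⟩
      exact mem_indicatorSpan hT.isPartition_group (hT.sigma_const X hX)
    have heq : sigmaSpan 𝒳 = indicatorSpan 𝒦 := by
      -- The dimensions are the numbers of blocks, so this is where `|𝒳| = |𝒦|` enters.
      refine Submodule.eq_of_le_of_finrank_eq hle ?_
      rw [finrank_sigmaSpan hT.isPartition_irr, finrank_indicatorSpan hT.isPartition_group]
      have := hT.card_eq
      rw [hfin, hfin'] at this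
      exact_mod_cast this
    refine ⟨eq_classes_of_rel_iff hT.isPartition_irr (fun X hX χ hχ ψ hψ => ?_)
        (fun X hX χ ψ h => ?_),
      eq_classes_of_rel_iff hT.isPartition_group (fun K hK g hg h hh X hX => ?_)
        (fun K hK g h hgh => ?_)⟩
    · refine irrSetoid_iff.mpr fun f hf => apply_eq_apply_of_mem_span ?_ (heq ▸ hf)
      rintro _ ⟨Y, hY, rfl⟩
      rw [irrCoeff_sigma, irrCoeff_sigma]
      by_cases hXY : X = Y
      · subst hXY
        simp [hχ, hψ]
      · have hd : Disjoint X Y := hT.isPartition_irr.pairwiseDisjoint hX hY hXY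
        simp [Set.disjoint_left.mp hd hχ, Set.disjoint_left.mp hd hψ]
    · have := irrSetoid_iff.mp h _ (heq ▸ sigma_mem_sigmaSpan hX)
      rw [irrCoeff_sigma, irrCoeff_sigma] at this
      exact mem_iff_mem_of_indicator_eq this
    · exact hT.sigma_const X hX K hK g hg h hh
    · exact mem_iff_mem_of_indicator_eq
        (classSetoid_iff.mp hgh _ (heq ▸ indicator_mem_indicatorSpan hK))
  · rintro ⟨hI, hC⟩
    have h𝒳 : Setoid.IsPartition 𝒳 := hI ▸ Setoid.isPartition_classes _
    have h𝒦 : Setoid.IsPartition 𝒦 := hC ▸ Setoid.isPartition_classes _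
    refine ⟨h𝒳, h𝒦, ?_, fun X hX K hK g hg h hh => ?_⟩
    · have h1 : sigmaSpan 𝒳 = indicatorSpan 𝒦 := by
        refine le_antisymm (hC ▸ sigmaSpan_le_indicatorSpan 𝒳) ?_
        conv_rhs => rw [← hI]
        exact indicatorSpan_le_sigmaSpan fun K hK =>
          isNormalSubset_of_mem_classPartition (hC ▸ hK)
      rw [hfin, hfin', ← finrank_sigmaSpan h𝒳, ← finrank_indicatorSpan h𝒦, h1]
    · subst hC
      exact rel_of_mem_classes hK hg hh X hX

end Spans

end SCT

namespace SCT

/-! ### Iterating two mutually compatible operators -/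

section Iteration

variable {α β : Type*}

theorem mem_classes_of {r : Setoid α} {A : Set α} (hne : A.Nonempty)
    (h1 : ∀ a ∈ A, ∀ b ∈ A, r a b) (h2 : ∀ a b, r a b → (a ∈ A ↔ b ∈ A)) : A ∈ r.classes := by
  obtain ⟨x, hx⟩ := hne
  exact ⟨x, Set.ext fun a => ⟨fun ha => h1 a ha x hx, fun ha => (h2 a x ha).mpr hx⟩⟩

theorem finer_classes {r s : Setoid α} (h : r ≤ s) : Finer r.classes s.classes := by
  rintro _ ⟨x, rfl⟩
  exact ⟨_, ⟨x, rfl⟩, fun _ ha => h ha⟩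

/-- The properties shared by the pairs of operators `(I, C)` and `(C, I)`, with the admissible
sets being the normal subsets of `G`, respectively all subsets of `Irr G`. -/
structure IsCompatible (F : Set (Set α) → Setoid β) (F' : Set (Set β) → Setoid α)
    (N : Set α → Prop) : Prop where
  anti : ∀ 𝒜 ℬ, 𝒜 ⊆ ℬ → F ℬ ≤ F 𝒜
  mono : ∀ r s : Setoid α, r ≤ s → F r.classes ≤ F s.classes
  mono' : ∀ r s : Setoid β, r ≤ s → F' r.classes ≤ F' s.classes
  admissible : ∀ 𝒜, ∀ A ∈ (F' 𝒜).classes, N A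
  mem_iff : ∀ 𝒜, (∀ A ∈ 𝒜, N A) → ∀ A ∈ 𝒜, ∀ a b, F' (F 𝒜).classes a b → (a ∈ A ↔ b ∈ A)

namespace IsCompatible

variable {F : Set (Set α) → Setoid β} {F' : Set (Set β) → Setoid α} {N : Set α → Prop}

/-- The `n`-th iterate of the composed operator. -/
def iter (F : Set (Set α) → Setoid β) (F' : Set (Set β) → Setoid α) (A : Set α) (n : ℕ) :
    Set (Set α) :=
  (fun 𝒜 => (F' (F 𝒜).classes).classes)^[n] {A}

theorem iter_succ (A : Set α) (n : ℕ) :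
    iter F F' A (n + 1) = (F' (F (iter F F' A n)).classes).classes :=
  Function.iterate_succ_apply' _ _ _

theorem iter_admissible (h : IsCompatible F F' N) {A : Set α} (hA : N A) (n : ℕ) :
    ∀ B ∈ iter F F' A n, N B := by
  cases n with
  | zero => rintro B rfl; exact hA
  | succ n => rw [iter_succ]; exact h.admissible _

/-- Every fixed pair having `A` as a block is finer than all the iterates of `{A}`. -/
theorem le_iter (h : IsCompatible F F' N) {A : Set α} (hA : N A) {𝒜 : Set (Set α)}
    {ℬ : Set (Set β)} (hF : (F 𝒜).classes = ℬ) (hF' : (F' ℬ).classes = 𝒜) (hmem : A ∈ 𝒜) (n : ℕ) :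
    A ∈ iter F F' A n ∧ F 𝒜 ≤ F (iter F F' A n) ∧
      F' ℬ ≤ F' (F (iter F F' A n)).classes := by
  induction n with
  | zero =>
    -- `{A}` need not be a partition, so the start uses inclusion of collections instead of
    -- refinement.
    have h1 : F 𝒜 ≤ F (iter F F' A 0) := h.anti _ _ (by rintro _ rfl; exact hmem)
    exact ⟨rfl, h1, hF ▸ h.mono' _ _ h1⟩
  | succ n ih =>
    obtain ⟨ih1, -, ih3⟩ := ih
    have h1 : F 𝒜 ≤ F (iter F F' A (n + 1)) := by
      rw [iter_succ]
      nth_rw 1 [← hF']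
      exact h.mono _ _ ih3
    refine ⟨?_, h1, hF ▸ h.mono' _ _ h1⟩
    rw [iter_succ]
    have hmem' : A ∈ (F' ℬ).classes := hF' ▸ hmem
    refine mem_classes_of (Set.nonempty_iff_ne_empty.mpr ?_)
      (fun a ha b hb => ih3 (rel_of_mem_classes hmem' ha hb))
      (h.mem_iff _ (h.iter_admissible hA n) A ih1)
    rintro rfl
    exact Setoid.empty_notMem_classes hmem'

/-- If `A` belongs to all the iterates of `{A}`, then the iterates become stationary. -/
theorem exists_iter_eq [Finite α] (h : IsCompatible F F' N) {A : Set α}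
    (hA : ∀ n, 0 < n → A ∈ iter F F' A n) :
    ∃ m, 0 < m ∧ ∀ n, m ≤ n → iter F F' A (n + 1) = iter F F' A n := by
  have hstep (n : ℕ) : F (iter F F' A (n + 1)) ≤ F (iter F F' A n) := by
    induction n with
    -- Only `{A} ⊆ iter F F' A 1` is needed; monotonicity propagates the descent from there.
    | zero => exact h.anti _ _ (by rintro _ rfl; exact hA 1 one_pos)
    | succ n ih =>
      rw [iter_succ A (n + 1)]
      nth_rw 2 [iter_succ A n]
      exact h.mono _ _ (h.mono' _ _ ih)
  have hanti : Antitone fun n => F' (F (iter F F' A n)).classes :=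
    antitone_nat_of_succ_le fun n => h.mono' _ _ (hstep n)
  have : Finite (Setoid α) := Finite.of_injective Setoid.classes fun r s => Setoid.classes_inj.mpr
  obtain ⟨m, hm⟩ := wellFoundedGT_iff_monotone_chain_condition.mp
    (inferInstance : WellFoundedGT (Setoid α)ᵒᵈ) ⟨fun n => OrderDual.toDual (F' (F (iter F F' A n)).classes), hanti⟩
  -- The chain of relations starts with the one whose classes form the first iterate, hence the
  -- shift by one.
  refine ⟨m + 1, m.succ_pos, fun n hn => ?_⟩
  obtain ⟨k, rfl⟩ := Nat.exists_eq_add_of_le' (Nat.one_le_of_lt hn)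
  have h1 := hm k (by omega)
  have h2 := hm (k + 1) (by omega)
  exact (iter_succ A (k + 1)).trans
    ((congrArg Setoid.classes (h2.symm.trans h1)).trans (iter_succ A k).symm)

theorem exists_fixed_iff [Finite α] (h : IsCompatible F F' N) {A : Set α} (hA : N A) :
    (∃ 𝒜 ℬ, ((F 𝒜).classes = ℬ ∧ (F' ℬ).classes = 𝒜) ∧ A ∈ 𝒜) ↔
      ∀ n, 0 < n → A ∈ iter F F' A n := by
  constructor
  · rintro ⟨𝒜, ℬ, ⟨hF, hF'⟩, hmem⟩ n -
    exact (h.le_iter hA hF hF' hmem n).1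
  · intro H
    obtain ⟨m, hm0, hm⟩ := h.exists_iter_eq H
    exact ⟨_, _, ⟨rfl, (iter_succ A m).symm.trans (hm m le_rfl)⟩, H m hm0⟩

theorem exists_coarsest [Finite α] (h : IsCompatible F F' N) {A : Set α} (hA : N A)
    (hex : ∃ 𝒜 ℬ, ((F 𝒜).classes = ℬ ∧ (F' ℬ).classes = 𝒜) ∧ A ∈ 𝒜) :
    ∃ m, ∀ n, m ≤ n →
      (F' (F (iter F F' A n)).classes).classes = iter F F' A n ∧ A ∈ iter F F' A n ∧
      ∀ 𝒜 ℬ, (F 𝒜).classes = ℬ → (F' ℬ).classes = 𝒜 → A ∈ 𝒜 →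
        Finer 𝒜 (iter F F' A n) ∧ Finer ℬ (F (iter F F' A n)).classes := by
  have H := (h.exists_fixed_iff hA).mp hex
  obtain ⟨m, hm0, hm⟩ := h.exists_iter_eq H
  refine ⟨m, fun n hn => ?_⟩
  have hfix := (iter_succ A n).symm.trans (hm n hn)
  refine ⟨hfix, H n (hm0.trans_le hn), fun 𝒜 ℬ hF hF' hmem => ?_⟩
  obtain ⟨-, h1, h2⟩ := h.le_iter hA hF hF' hmem n
  exact ⟨hfix ▸ hF' ▸ finer_classes h2, hF ▸ finer_classes h1⟩

end IsCompatible

end Iteration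

theorem isCompatible_irr_class (G : Type*) [Group G] [Finite G] :
    IsCompatible (irrSetoid (G := G)) classSetoid IsNormalSubset where
  anti _ _ hs _ _ h K hK := h K (hs hK)
  mono _ _ := irrSetoid_mono
  mono' _ _ := classSetoid_mono
  admissible _ _ := isNormalSubset_of_mem_classPartition
  mem_iff _ h𝒦 _ hK _ _ := mem_iff_mem_of_classSetoid_irrPartition h𝒦 hK

/-- No admissibility condition arises on this side, because every `σ_X` is a class function. -/
theorem isCompatible_class_irr (G : Type*) [Group G] [Finite G] :
    IsCompatible (classSetoid (G := G)) irrSetoid fun _ => True where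
  anti _ _ hs _ _ h X hX := h X (hs hX)
  mono _ _ := classSetoid_mono
  mono' _ _ := irrSetoid_mono
  admissible _ _ _ := trivial
  mem_iff _ _ _ hX _ _ := mem_iff_mem_of_irrSetoid_classPartition hX

end SCT

theorem mainTheorem7 {G : Type*} [Group G] [Finite G] :
    (∀ K : Set G, SCT.IsNormalSubset K →
      ((∃ (𝒳 : Set (Set (SCT.Irr G))) (𝒦 : Set (Set G)),
          SCT.IsSupercharacterTheory 𝒳 𝒦 ∧ K ∈ 𝒦) ↔
        ∀ n : ℕ, 0 < n → K ∈ SCT.iterCI n {K}) ∧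
      ((∃ (𝒳 : Set (Set (SCT.Irr G))) (𝒦 : Set (Set G)),
          SCT.IsSupercharacterTheory 𝒳 𝒦 ∧ K ∈ 𝒦) →
        ∃ N : ℕ, ∀ n : ℕ, N ≤ n →
          SCT.IsCoarsestWith (fun _ 𝒦 => K ∈ 𝒦)
            (SCT.irrPartition (SCT.iterCI n {K})) (SCT.iterCI n {K}))) ∧
    (∀ X : Set (SCT.Irr G),
      ((∃ (𝒳 : Set (Set (SCT.Irr G))) (𝒦 : Set (Set G)),
          SCT.IsSupercharacterTheory 𝒳 𝒦 ∧ X ∈ 𝒳) ↔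
        ∀ n : ℕ, 0 < n → X ∈ SCT.iterIC n {X}) ∧
      ((∃ (𝒳 : Set (Set (SCT.Irr G))) (𝒦 : Set (Set G)),
          SCT.IsSupercharacterTheory 𝒳 𝒦 ∧ X ∈ 𝒳) →
        ∃ N : ℕ, ∀ n : ℕ, N ≤ n →
          SCT.IsCoarsestWith (fun 𝒳 _ => X ∈ 𝒳)
            (SCT.iterIC n {X}) (SCT.classPartition (SCT.iterIC n {X})))) := by
  simp only [SCT.IsCoarsestWith, SCT.isSupercharacterTheory_iff]
  refine ⟨fun K hK => ?_, fun X => ?_⟩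
  · have h := SCT.isCompatible_irr_class G
    have hswap : (∃ (𝒳 : Set (Set (SCT.Irr G))) (𝒦 : Set (Set G)),
        (SCT.irrPartition 𝒦 = 𝒳 ∧ SCT.classPartition 𝒳 = 𝒦) ∧ K ∈ 𝒦) ↔
        ∃ (𝒦 : Set (Set G)) (𝒳 : Set (Set (SCT.Irr G))),
          (SCT.irrPartition 𝒦 = 𝒳 ∧ SCT.classPartition 𝒳 = 𝒦) ∧ K ∈ 𝒦 := exists_comm
    refine ⟨hswap.trans (h.exists_fixed_iff hK), fun hex => ?_⟩
    obtain ⟨m, hm⟩ := h.exists_coarsest hK (hswap.mp hex)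
    refine ⟨m, fun n hn => ?_⟩
    obtain ⟨hfix, hmem, hmin⟩ := hm n hn
    exact ⟨⟨trivial, hfix⟩, hmem, fun 𝒴 ℒ hT hKℒ => (hmin ℒ 𝒴 hT.1 hT.2 hKℒ).symm⟩
  · have h := SCT.isCompatible_class_irr G
    have hswap : (∃ (𝒳 : Set (Set (SCT.Irr G))) (𝒦 : Set (Set G)),
        (SCT.irrPartition 𝒦 = 𝒳 ∧ SCT.classPartition 𝒳 = 𝒦) ∧ X ∈ 𝒳) ↔
        ∃ (𝒳 : Set (Set (SCT.Irr G))) (𝒦 : Set (Set G)),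
          (SCT.classPartition 𝒳 = 𝒦 ∧ SCT.irrPartition 𝒦 = 𝒳) ∧ X ∈ 𝒳 := by
      simp only [and_comm]
    refine ⟨hswap.trans (h.exists_fixed_iff trivial), fun hex => ?_⟩
    obtain ⟨m, hm⟩ := h.exists_coarsest trivial (hswap.mp hex)
    refine ⟨m, fun n hn => ?_⟩
    obtain ⟨hfix, hmem, hmin⟩ := hm n hn
    exact ⟨⟨hfix, trivial⟩, hmem, fun 𝒴 ℒ hT hX => hmin 𝒴 ℒ hT.2 hT.1 hX⟩
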